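/- Consider the discrete-time system $x_{k+1}=G(x_k,u_k)$ with finite input alphabet $U$, open state space $X\subseteq\mathbb{R}^n$ and right hand side $G\colon X\times U\to X$. Assume that for every $w\in U$ the map $G(\cdot,w)$ is a $C^1$-diffeomorphism of $X$ onto an open subset of $X$ and is of class $C^{1,1}$, i.e. its derivative is locally Lipschitz continuous. Let $\psi$ denote the general solution: $\psi(0,x,u)=x$ and $\psi(k+1,x,u)=G(\psi(k,x,u),u_k)$. Call a set strongly convex if, for some $r>0$, it is an intersection of a family of closed Euclidean balls of radius $r$; a convex polyhedron is the solution set of finitely many (non-strict) linear inequalities. Let $N\in\mathbb{N}$, let $K\subseteq X$ be compact, let $V\subseteq X$ be an open neighborhood of $K$, let $Y\subseteq\mathbb{R}^n$ be a full-dimensional convex polyhedron, and let $\widehat Y\subseteq\mathbb{R}^n$ be a strongly convex set with $Y\subseteq\widehat Y\neq\mathbb{R}^n$. Then there are a finite set $Z\subseteq\mathbb{R}^n$, a real number $\lambda>0$ and a superset $C$ of $C'=\{z+\lambda Y : z\in Z\}$ such that $$K\subseteq Z+\lambda Y\subseteq Z+\lambda\widehat Y\subseteq V$$ and such that the following quantizer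 hypothesis holds: $U$ is finite, $C$ is a finite covering of $\mathbb{R}^n$ by nonempty convex polyhedra, and each cell $\Delta\in C'$ has a superset $\widehat\Delta\subseteq X$ for which $\psi(k,\widehat\Delta,u)$ is convex for all $k\in\{1,\dots,N\}$ and all $u\colon\{0,\dots,k-1\}\to U$; more precisely, for $\Delta=z+\lambda Y$ with $z\in Z$ one may take $\widehat\Delta=z+\lambda\widehat Y$. Moreover, $\Delta\cap\operatorname{int}\Delta'=\emptyset$ for all $\Delta\in C\setminus C'$ and all $\Delta'\in C'$, and one may additionally require $\Delta\cap K=\emptyset$ for all $\Delta\in C\setminus C'$. -/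

import Mathlib

open scoped Pointwise

namespace QuantizedSystem

/-- `f` is of class `C^{1,1}` on the open set `X`: it is continuously differentiable there, and its
derivative is locally Lipschitz continuous. -/
def IsC11On {n : ℕ} (f : EuclideanSpace ℝ (Fin n) → EuclideanSpace ℝ (Fin n))
    (X : Set (EuclideanSpace ℝ (Fin n))) : Prop :=
  ContDiffOn ℝ 1 f X ∧ LocallyLipschitzOn X (fderiv ℝ f)

/-- `f` maps `X` into `X` and is a `C^1`-diffeomorphism of `X` onto an open subset of `X`. -/
structure IsC1DiffeoOntoOpenSubset {n : ℕ}
    (f : EuclideanSpace ℝ (Fin n) → EuclideanSpace ℝ (Fin n))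
    (X : Set (EuclideanSpace ℝ (Fin n))) : Prop where
  mapsTo : Set.MapsTo f X X
  isOpen_image : IsOpen (f '' X)
  contDiffOn : ContDiffOn ℝ 1 f X
  exists_inverse : ∃ g : EuclideanSpace ℝ (Fin n) → EuclideanSpace ℝ (Fin n),
    Set.LeftInvOn g f X ∧ ContDiffOn ℝ 1 g (f '' X)

/-- The standing hypothesis on the right hand side `G : X × U → X` of the system
`x (k + 1) = G (x k, u k)`, with smoothness `C^{1,1}`: the state space `X ⊆ ℝⁿ` is open and each
`G (·, w)` is a `C^1`-diffeomorphism onto an open subset of `X` and is of class `C^{1,1}`.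
The values of `G` outside `X` play no role. -/
structure DiffeoHypothesisC11 {n : ℕ} {U : Type*} (X : Set (EuclideanSpace ℝ (Fin n)))
    (G : EuclideanSpace ℝ (Fin n) → U → EuclideanSpace ℝ (Fin n)) : Prop where
  isOpen_state : IsOpen X
  diffeo : ∀ w : U, IsC1DiffeoOntoOpenSubset (fun x => G x w) X
  smooth : ∀ w : U, IsC11On (fun x => G x w) X

/-- The general solution `ψ(k, x₀, u)` of `x (k + 1) = G (x k, u k)`. -/
def generalSolution {n : ℕ} {U : Type*}
    (G : EuclideanSpace ℝ (Fin n) → U → EuclideanSpace ℝ (Fin n)) :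
    ℕ → EuclideanSpace ℝ (Fin n) → (ℕ → U) → EuclideanSpace ℝ (Fin n)
  | 0, x, _ => x
  | k + 1, x, u => G (generalSolution G k x u) (u k)

/-- The attainable set `ψ(k, Ω, u)`. Only the values of `u` on `{0, …, k - 1}` matter. -/
def attainableSet {n : ℕ} {U : Type*}
    (G : EuclideanSpace ℝ (Fin n) → U → EuclideanSpace ℝ (Fin n))
    (k : ℕ) (Ω : Set (EuclideanSpace ℝ (Fin n))) (u : ℕ → U) : Set (EuclideanSpace ℝ (Fin n)) :=
  (fun x => generalSolution G k x u) '' Ω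

/-- A convex polyhedron: the solution set of finitely many linear inequalities. -/
def IsConvexPolyhedron {n : ℕ} (P : Set (EuclideanSpace ℝ (Fin n))) : Prop :=
  ∃ (m : ℕ) (a : Fin m → EuclideanSpace ℝ (Fin n)) (b : Fin m → ℝ),
    P = {x | ∀ i, inner ℝ (a i) x ≤ b i}

/-- Strong convexity: the set is an intersection of closed Euclidean balls of one common positive
radius. The empty family, whose intersection is the whole space, is allowed. -/
def IsStronglyConvex {n : ℕ} (Ω : Set (EuclideanSpace ℝ (Fin n))) : Prop :=
  ∃ r : ℝ, 0 < r ∧ ∃ M : Set (EuclideanSpace ℝ (Fin n)), Ω = ⋂ x ∈ M, Metric.closedBall x r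

/-- The quantizer hypothesis, for the system of cells `C`, the operating range cells `C' ⊆ C` and
the memory span `N`. -/
structure QuantizerHypothesis {n : ℕ} {U : Type*} (X : Set (EuclideanSpace ℝ (Fin n)))
    (G : EuclideanSpace ℝ (Fin n) → U → EuclideanSpace ℝ (Fin n)) (N : ℕ)
    (C C' : Set (Set (EuclideanSpace ℝ (Fin n)))) : Prop where
  finite_inputs : Finite U
  finite_cells : C.Finite
  covers : ⋃₀ C = Set.univ
  nonempty : ∀ Δ ∈ C, Δ.Nonempty
  polyhedral : ∀ Δ ∈ C, IsConvexPolyhedron Δ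
  subset : C' ⊆ C
  exists_superset : ∀ Δ ∈ C', ∃ Δhat : Set (EuclideanSpace ℝ (Fin n)),
    Δ ⊆ Δhat ∧ Δhat ⊆ X ∧
      ∀ k ∈ Finset.Icc 1 N, ∀ u : ℕ → U, Convex ℝ (attainableSet G k Δhat u)

/-- The system `C' = {z + lam Y | z ∈ Z}` of scaled and translated copies of `Y`. -/
def scaledCopies {n : ℕ} (Z : Set (EuclideanSpace ℝ (Fin n))) (lam : ℝ)
    (Y : Set (EuclideanSpace ℝ (Fin n))) : Set (Set (EuclideanSpace ℝ (Fin n))) :=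
  (fun z => {z} + lam • Y) '' Z

end QuantizedSystem

/-! Each iterate of the system is injective, hence commutes with intersections. A copy `z + λ Ŷ` is
an intersection of balls of radius `λ r`, so its attainable sets are convex as soon as those of the
balls are.

For balls this is Polyak's argument. The midpoint of `f x` and `f y` has a preimage `z`; the
`C^{1,1}` bound and the Lipschitz inverse put `z` within a constant times `‖x - y‖²` of the midpoint
of `x` and `y`. A ball of radius `r` tolerates a displacement `‖x - y‖² / (8 r)` there, so small
balls have midpoint convex compact images
(`IsMidpointRegularAt.eventually_convex_image_closedBall`).

Finitely many inputs and compactness of `K` make one scale `λ` work (`exists_scale`). Finitely many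
interiors of copies of `Y` cover `K`; the complement of these interiors splits into polyhedra
(`exists_polyhedral_completion`), which provide the remaining cells. -/

open Filter Topology Set Metric

namespace QuantizedSystem

/-! ### Convexity of images of small balls. -/

section ConvexImages

variable {E F H : Type*} [NormedAddCommGroup E] [NormedAddCommGroup F] [NormedAddCommGroup H]

/-- A closed midpoint convex set is convex. -/
theorem convex_of_isClosed_of_midpoint [NormedSpace ℝ E] {S : Set E} (hS : IsClosed S)
    (hmid : ∀ x ∈ S, ∀ y ∈ S, (1 / 2 : ℝ) • (x + y) ∈ S) : Convex ℝ S := by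
  rw [convex_iff_segment_subset]
  intro x hx y hy
  rw [segment_eq_image_lineMap]
  rintro _ ⟨t, ht, rfl⟩
  by_contra hc
  have hcont : Continuous (AffineMap.lineMap x y : ℝ → E) := AffineMap.lineMap_continuous
  have hT : IsClosed ((AffineMap.lineMap x y : ℝ → E) ⁻¹' S) := hS.preimage hcont
  -- `(a, b)` is the gap of `S` around the missing parameter `t`; its midpoint would lie in `S`,
  -- contradicting extremality of `a` or `b`.
  obtain ⟨a, ⟨⟨ha0, hat⟩, haS⟩, ha⟩ :=
    ((isCompact_Icc (a := (0 : ℝ)) (b := t)).inter_right hT).exists_isGreatest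
      ⟨0, ⟨le_rfl, ht.1⟩, by simpa using hx⟩
  obtain ⟨b, ⟨⟨htb, hb1⟩, hbS⟩, hb⟩ :=
    ((isCompact_Icc (a := t) (b := (1 : ℝ))).inter_right hT).exists_isLeast
      ⟨1, ⟨ht.2, le_rfl⟩, by simpa using hy⟩
  have hat' : a < t := lt_of_le_of_ne hat fun h => hc (h ▸ haS)
  have htb' : t < b := lt_of_le_of_ne htb fun h => hc (h ▸ hbS)
  have hm : (a + b) / 2 ∈ (AffineMap.lineMap x y : ℝ → E) ⁻¹' S := by
    have := hmid _ haS _ hbS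
    rw [mem_preimage]
    convert this using 1
    simp only [AffineMap.lineMap_apply_module]
    module
  rcases le_total ((a + b) / 2) t with h | h
  · have := ha ⟨⟨by linarith, h⟩, hm⟩
    linarith
  · have := hb ⟨⟨h, by linarith⟩, hm⟩
    linarith

/-- Strong convexity of a ball: a neighborhood of the midpoint of a chord, of radius quadratic in
the length of the chord, is contained in the ball. -/
theorem mem_closedBall_of_near_midpoint [InnerProductSpace ℝ E] {c x y z : E} {r : ℝ} (hr : 0 < r)
    (hx : x ∈ closedBall c r) (hy : y ∈ closedBall c r)
    (hz : ‖z - (1 / 2 : ℝ) • (x + y)‖ ≤ ‖x - y‖ ^ 2 / (8 * r)) : z ∈ closedBall c r := by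
  rw [mem_closedBall_iff_norm] at *
  have hpar := parallelogram_law_with_norm ℝ (x - c) (y - c)
  have hsum : ‖(x - c) + (y - c)‖ = 2 * ‖(1 / 2 : ℝ) • (x + y) - c‖ := by
    have h : (x - c) + (y - c) = (2 : ℝ) • ((1 / 2 : ℝ) • (x + y) - c) := by module
    rw [h, norm_smul, Real.norm_ofNat]
  rw [hsum, sub_sub_sub_cancel_right] at hpar
  have hx2 : ‖x - c‖ ^ 2 ≤ r ^ 2 := by gcongr
  have hy2 : ‖y - c‖ ^ 2 ≤ r ^ 2 := by gcongr
  set s := ‖(1 / 2 : ℝ) • (x + y) - c‖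
  set d := ‖x - y‖
  set e := d ^ 2 / (8 * r) with he
  have her : d ^ 2 = 8 * r * e := by rw [he]; field_simp
  have hs2 : s ^ 2 ≤ r ^ 2 - 2 * r * e := by nlinarith
  have her' : e ≤ r := by nlinarith [sq_nonneg s]
  have hsr : s ≤ r - e := abs_le_of_sq_le_sq' (by nlinarith [sq_nonneg e]) (by linarith) |>.2
  calc ‖z - c‖ = ‖(z - (1 / 2 : ℝ) • (x + y)) + ((1 / 2 : ℝ) • (x + y) - c)‖ := by
        rw [sub_add_sub_cancel]
    _ ≤ _ := norm_add_le _ _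
    _ ≤ r := by linarith

/-- Near `p`, the map `f` is bi-Lipschitz and open, and it maps midpoints to midpoints up to an
error that is quadratic in the length of the chord. -/
structure IsMidpointRegularAt [NormedSpace ℝ E] [NormedSpace ℝ F] (f : E → F) (p : E) : Prop where
  map_nhds : map f (𝓝 p) = 𝓝 (f p)
  lipschitz : ∃ M : ℝ, 0 ≤ M ∧ ∀ᶠ q : E × E in 𝓝 (p, p), ‖f q.1 - f q.2‖ ≤ M * ‖q.1 - q.2‖
  antilipschitz : ∃ M : ℝ, 0 ≤ M ∧ ∀ᶠ q : E × E in 𝓝 (p, p), ‖q.1 - q.2‖ ≤ M * ‖f q.1 - f q.2‖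
  midpoint_defect : ∃ M : ℝ, 0 ≤ M ∧ ∀ᶠ q : E × E in 𝓝 (p, p),
    ‖f ((1 / 2 : ℝ) • (q.1 + q.2)) - (1 / 2 : ℝ) • (f q.1 + f q.2)‖ ≤ M * ‖q.1 - q.2‖ ^ 2

theorem tendsto_half_smul_add [NormedSpace ℝ E] (p : E) :
    Tendsto (fun q : E × E => (1 / 2 : ℝ) • (q.1 + q.2)) (𝓝 (p, p)) (𝓝 p) := by
  have h : Continuous fun q : E × E => (1 / 2 : ℝ) • (q.1 + q.2) := by fun_prop
  convert h.tendsto (p, p) using 2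
  module

namespace IsMidpointRegularAt

variable [NormedSpace ℝ E] [NormedSpace ℝ F] [NormedSpace ℝ H]

theorem tendsto {f : E → F} {p : E} (hf : IsMidpointRegularAt f p) :
    Tendsto f (𝓝 p) (𝓝 (f p)) :=
  hf.map_nhds.le

theorem id (p : E) : IsMidpointRegularAt (fun x : E => x) p where
  map_nhds := map_id
  lipschitz := ⟨1, zero_le_one, by simp⟩
  antilipschitz := ⟨1, zero_le_one, by simp⟩
  midpoint_defect := ⟨0, le_rfl, by simp⟩

/-- The defect of `g ∘ f` is the defect of `f` carried through the Lipschitz map `g`, plus the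
defect of `g` on a chord stretched by at most `L`. This closure property lets the iterates inherit
regularity from single steps. -/
theorem comp {g : F → H} {f : E → F} {p : E} (hg : IsMidpointRegularAt g (f p))
    (hf : IsMidpointRegularAt f p) : IsMidpointRegularAt (fun x => g (f x)) p := by
  have hpair : Tendsto (fun q : E × E => (f q.1, f q.2)) (𝓝 (p, p)) (𝓝 (f p, f p)) := by
    rw [nhds_prod_eq, nhds_prod_eq]
    exact hf.tendsto.prodMap hf.tendsto
  have hmid : Tendsto (fun q : E × E => (f ((1 / 2 : ℝ) • (q.1 + q.2)),
      (1 / 2 : ℝ) • (f q.1 + f q.2))) (𝓝 (p, p)) (𝓝 (f p, f p)) := by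
    rw [nhds_prod_eq (x := f p)]
    exact (hf.tendsto.comp (tendsto_half_smul_add p)).prodMk
      ((tendsto_half_smul_add (f p)).comp hpair)
  obtain ⟨L, hL0, hL⟩ := hf.lipschitz
  obtain ⟨L', hL0', hL'⟩ := hg.lipschitz
  obtain ⟨A, hA0, hA⟩ := hf.antilipschitz
  obtain ⟨A', hA0', hA'⟩ := hg.antilipschitz
  obtain ⟨D, hD0, hD⟩ := hf.midpoint_defect
  obtain ⟨D', hD0', hD'⟩ := hg.midpoint_defect
  refine ⟨?_, ⟨L' * L, by positivity, ?_⟩, ⟨A * A', by positivity, ?_⟩,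
    ⟨L' * D + D' * L ^ 2, by positivity, ?_⟩⟩
  · rw [← hg.map_nhds, ← hf.map_nhds, Filter.map_map]
    rfl
  · filter_upwards [hL, hpair.eventually hL'] with q h1 h2
    calc _ ≤ _ := h2
      _ ≤ L' * (L * ‖q.1 - q.2‖) := by gcongr
      _ = _ := by ring
  · filter_upwards [hA, hpair.eventually hA'] with q h1 h2
    calc _ ≤ _ := h1
      _ ≤ A * (A' * ‖g (f q.1) - g (f q.2)‖) := by gcongr
      _ = _ := by ring
  · filter_upwards [hL, hD, hpair.eventually hD', hmid.eventually hL'] with q h1 h2 h3 h4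
    calc _ ≤ ‖g (f ((1 / 2 : ℝ) • (q.1 + q.2))) - g ((1 / 2 : ℝ) • (f q.1 + f q.2))‖
          + ‖g ((1 / 2 : ℝ) • (f q.1 + f q.2)) - (1 / 2 : ℝ) • (g (f q.1) + g (f q.2))‖ :=
          norm_sub_le_norm_sub_add_norm_sub _ _ _
      _ ≤ L' * (D * ‖q.1 - q.2‖ ^ 2) + D' * (L * ‖q.1 - q.2‖) ^ 2 := by
          refine add_le_add (h4.trans (by gcongr)) (h3.trans (by gcongr))
      _ = _ := by ring

end IsMidpointRegularAt

theorem eventually_prod_closedBall_subset {p : E} {W : Set E} (hW : W ∈ 𝓝 p) :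
    ∀ᶠ q : E × ℝ in 𝓝 p ×ˢ 𝓝[>] 0, closedBall q.1 q.2 ⊆ W := by
  obtain ⟨ε, hε, hεW⟩ := Metric.mem_nhds_iff.1 hW
  filter_upwards [prod_mem_prod (ball_mem_nhds p (half_pos hε)) (Ioo_mem_nhdsGT (half_pos hε))]
    with q hq
  refine (closedBall_subset_ball' ?_).trans hεW
  linarith [hq.2.2, mem_ball.1 hq.1]

/-- Polyak's theorem: small balls have convex images. -/
theorem IsMidpointRegularAt.eventually_convex_image_closedBall [InnerProductSpace ℝ E]
    [ProperSpace E] [NormedSpace ℝ F] {f : E → F} {p : E} (hf : IsMidpointRegularAt f p) :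
    ∀ᶠ q : E × ℝ in 𝓝 p ×ˢ 𝓝[>] 0, Convex ℝ (f '' closedBall q.1 q.2) := by
  obtain ⟨L, hL0, hL⟩ := hf.lipschitz
  obtain ⟨A, hA0, hA⟩ := hf.antilipschitz
  obtain ⟨D, hD0, hD⟩ := hf.midpoint_defect
  have hall := hL.and (hA.and hD)
  rw [nhds_prod_eq] at hall
  obtain ⟨W, hW, hWW⟩ := mem_prod_self_iff.1 hall
  have hWall : ∀ x ∈ W, ∀ y ∈ W, ‖f x - f y‖ ≤ L * ‖x - y‖ ∧ ‖x - y‖ ≤ A * ‖f x - f y‖ ∧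
      ‖f ((1 / 2 : ℝ) • (x + y)) - (1 / 2 : ℝ) • (f x + f y)‖ ≤ D * ‖x - y‖ ^ 2 :=
    fun x hx y hy => hWW (mk_mem_prod hx hy)
  have hfW : f '' W ∈ 𝓝 (f p) := hf.map_nhds ▸ image_mem_map hW
  obtain ⟨δ, hδ, hδW⟩ := Metric.mem_nhds_iff.1 hfW
  have hW' : W ∩ f ⁻¹' ball (f p) δ ∈ 𝓝 p :=
    inter_mem hW (hf.tendsto (ball_mem_nhds _ hδ))
  obtain ⟨ε, hε, hεW⟩ := Metric.mem_nhds_iff.1 hW'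
  -- The threshold ensures `A * D ≤ 1 / (8 * r)`; the `+ 1` guards against `A * D = 0`.
  have hsmall : ∀ᶠ q : E × ℝ in 𝓝 p ×ˢ 𝓝[>] 0, q.2 ∈ Ioo 0 (1 / (8 * (A * D) + 1)) :=
    tendsto_snd.eventually (Ioo_mem_nhdsGT (by positivity))
  filter_upwards [eventually_prod_closedBall_subset (ball_mem_nhds p hε), hsmall] with q hq hq2
  obtain ⟨c, r⟩ := q
  obtain ⟨hr0, hr⟩ : 0 < r ∧ r < 1 / (8 * (A * D) + 1) := hq2
  have hr' : 8 * r * (A * D) ≤ 1 := by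
    rw [lt_div_iff₀ (by positivity)] at hr
    linarith
  change closedBall c r ⊆ ball p ε at hq
  have hcont : ContinuousOn f (closedBall c r) := by
    refine LipschitzOnWith.continuousOn (K := ⟨L, hL0⟩)
      (LipschitzOnWith.of_dist_le_mul fun x hx y hy => ?_)
    rw [dist_eq_norm, dist_eq_norm]
    exact (hWall x (hεW (hq hx)).1 y (hεW (hq hy)).1).1
  refine convex_of_isClosed_of_midpoint
    ((isCompact_closedBall c r).image_of_continuousOn hcont).isClosed ?_
  rintro _ ⟨x, hx, rfl⟩ _ ⟨y, hy, rfl⟩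
  have hxW := hεW (hq hx)
  have hyW := hεW (hq hy)
  have hm : (1 / 2 : ℝ) • (x + y) ∈ closedBall c r := by
    refine mem_closedBall_of_near_midpoint hr0 hx hy ?_
    rw [sub_self, norm_zero]
    positivity
  have hfm : (1 / 2 : ℝ) • (f x + f y) ∈ ball (f p) δ := by
    have hball := convex_ball (f p) δ
    have := hball hxW.2 hyW.2 (a := 1 / 2) (b := 1 / 2) (by norm_num) (by norm_num) (by norm_num)
    rwa [← smul_add] at this
  obtain ⟨z, hz, hzeq⟩ := hδW hfm
  refine ⟨z, mem_closedBall_of_near_midpoint hr0 hx hy ?_, hzeq⟩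
  calc ‖z - (1 / 2 : ℝ) • (x + y)‖ ≤ A * ‖f z - f ((1 / 2 : ℝ) • (x + y))‖ :=
        (hWall z hz _ (hεW (hq hm)).1).2.1
    _ = A * ‖f ((1 / 2 : ℝ) • (x + y)) - (1 / 2 : ℝ) • (f x + f y)‖ := by
        rw [hzeq, norm_sub_rev]
    _ ≤ A * (D * ‖x - y‖ ^ 2) := by
        gcongr
        exact (hWall x hxW.1 y hyW.1).2.2
    _ ≤ ‖x - y‖ ^ 2 / (8 * r) := by
        rw [le_div_iff₀ (by positivity)]
        nlinarith [sq_nonneg ‖x - y‖]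

/-- A differentiable map with Lipschitz derivative has quadratic midpoint defect. -/
theorem norm_midpoint_defect_le [NormedSpace ℝ E] [NormedSpace ℝ F] {f : E → F} {S : Set E}
    (hS : Convex ℝ S) {f' : E → E →L[ℝ] F} (hf : ∀ x ∈ S, HasFDerivAt f (f' x) x) {L : NNReal}
    (hL : LipschitzOnWith L f' S) {x y : E} (hx : x ∈ S) (hy : y ∈ S) :
    ‖f ((1 / 2 : ℝ) • (x + y)) - (1 / 2 : ℝ) • (f x + f y)‖ ≤ L * ‖x - y‖ ^ 2 := by
  set m := (1 / 2 : ℝ) • (x + y) with hm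
  set d := ‖x - y‖
  have hmS : m ∈ S := by
    have := hS hx hy (a := 1 / 2) (b := 1 / 2) (by norm_num) (by norm_num) (by norm_num)
    rwa [← smul_add] at this
  -- First-order expansion at the midpoint `m`: the two endpoints are opposite, so the linear terms
  -- cancel in the defect.
  have key : ∀ w ∈ S, ‖w - m‖ = d / 2 → ‖f w - f m - f' m (w - m)‖ ≤ L * (d / 2) * (d / 2) := by
    intro w hw hwm
    have := Convex.norm_image_sub_le_of_norm_hasFDerivWithin_le' (f := f) (f' := f') (φ := f' m)
      (C := L * (d / 2)) (s := S ∩ closedBall m (d / 2)) (x := m) (y := w)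
      (fun z hz => (hf z hz.1).hasFDerivWithinAt)
      (fun z hz => (hL.norm_sub_le hz.1 hmS).trans (by
        gcongr
        exact mem_closedBall_iff_norm.1 hz.2))
      (hS.inter (convex_closedBall _ _)) ⟨hmS, mem_closedBall_self (by positivity)⟩
      ⟨hw, mem_closedBall_iff_norm.2 hwm.le⟩
    rwa [hwm] at this
  have hxm : x - m = (1 / 2 : ℝ) • (x - y) := by rw [hm]; module
  have hym : y - m = -((1 / 2 : ℝ) • (x - y)) := by rw [hm]; module
  have hn : ‖(1 / 2 : ℝ) • (x - y)‖ = d / 2 := by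
    rw [norm_smul, Real.norm_of_nonneg (by norm_num)]
    ring
  have h1 := key x hx (by rw [hxm, hn])
  have h2 := key y hy (by rw [hym, norm_neg, hn])
  have hsum : f m - (1 / 2 : ℝ) • (f x + f y) =
      -((1 / 2 : ℝ) • ((f x - f m - f' m (x - m)) + (f y - f m - f' m (y - m)))) := by
    rw [hxm, hym, map_neg]
    module
  rw [hsum, norm_neg, norm_smul, Real.norm_of_nonneg (by norm_num)]
  have h3 := norm_add_le (f x - f m - f' m (x - m)) (f y - f m - f' m (y - m))
  nlinarith [L.coe_nonneg, mul_nonneg L.coe_nonneg (sq_nonneg d)]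

theorem eventually_norm_sub_le_of_contDiffAt [NormedSpace ℝ E] [NormedSpace ℝ F] {f : E → F} {p : E}
    (hf : ContDiffAt ℝ 1 f p) :
    ∃ M : ℝ, 0 ≤ M ∧ ∀ᶠ q : E × E in 𝓝 (p, p), ‖f q.1 - f q.2‖ ≤ M * ‖q.1 - q.2‖ := by
  obtain ⟨M, W, hW, hM⟩ := hf.exists_lipschitzOnWith
  refine ⟨M, M.coe_nonneg, ?_⟩
  filter_upwards [prod_mem_nhds hW hW] with q hq
  exact hM.norm_sub_le hq.1 hq.2

end ConvexImages

/-! ### Regularity and convexity for the general solution. -/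

section System

variable {n : ℕ} {U : Type*} {X : Set (EuclideanSpace ℝ (Fin n))}

theorem IsC1DiffeoOntoOpenSubset.injOn {f : EuclideanSpace ℝ (Fin n) → EuclideanSpace ℝ (Fin n)}
    (hf : IsC1DiffeoOntoOpenSubset f X) : InjOn f X := by
  obtain ⟨g, hg, -⟩ := hf.exists_inverse
  exact hg.injOn

theorem IsC1DiffeoOntoOpenSubset.isMidpointRegularAt
    {f : EuclideanSpace ℝ (Fin n) → EuclideanSpace ℝ (Fin n)}
    (hX : IsOpen X) (hf : IsC1DiffeoOntoOpenSubset f X) (hf' : IsC11On f X)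
    {p : EuclideanSpace ℝ (Fin n)} (hp : p ∈ X) : IsMidpointRegularAt f p := by
  obtain ⟨g, hg, hgd⟩ := hf.exists_inverse
  have hfX : f '' X ∈ 𝓝 (f p) := hf.isOpen_image.mem_nhds (mem_image_of_mem f hp)
  have hfp : ContDiffAt ℝ 1 f p := hf.contDiffOn.contDiffAt (hX.mem_nhds hp)
  have hgp : ContDiffAt ℝ 1 g (f p) := hgd.contDiffAt hfX
  have hfc : Tendsto f (𝓝 p) (𝓝 (f p)) := hfp.continuousAt
  have hgc : Tendsto g (𝓝 (f p)) (𝓝 p) := by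
    have := hgp.continuousAt.tendsto
    rwa [hg hp] at this
  have hXX : ∀ᶠ q : EuclideanSpace ℝ (Fin n) × EuclideanSpace ℝ (Fin n) in 𝓝 (p, p),
      q ∈ X ×ˢ X := prod_mem_nhds (hX.mem_nhds hp) (hX.mem_nhds hp)
  refine ⟨le_antisymm hfc fun S hS => ?_, eventually_norm_sub_le_of_contDiffAt hfp, ?_, ?_⟩
  · filter_upwards [hfX, hgc (mem_map.1 hS)] with y hy hyS
    obtain ⟨x, hx, rfl⟩ := hy
    rw [mem_preimage, hg hx] at hyS
    exact hyS
  · obtain ⟨M, hM0, hM⟩ := eventually_norm_sub_le_of_contDiffAt hgp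
    have hpair : Tendsto (fun q : EuclideanSpace ℝ (Fin n) × EuclideanSpace ℝ (Fin n) =>
        (f q.1, f q.2)) (𝓝 (p, p)) (𝓝 (f p, f p)) := by
      rw [nhds_prod_eq, nhds_prod_eq]
      exact hfc.prodMap hfc
    refine ⟨M, hM0, ?_⟩
    filter_upwards [hpair.eventually hM, hXX] with q hq hqX
    rwa [hg hqX.1, hg hqX.2] at hq
  · obtain ⟨L, W, hW, hL⟩ := hf'.2 hp
    rw [hX.nhdsWithin_eq hp] at hW
    obtain ⟨ε, hε, hεW⟩ := Metric.mem_nhds_iff.1 (inter_mem hW (hX.mem_nhds hp))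
    refine ⟨L, L.coe_nonneg, ?_⟩
    filter_upwards [prod_mem_nhds (ball_mem_nhds p hε) (ball_mem_nhds p hε)] with q hq
    refine norm_midpoint_defect_le (convex_ball p ε) (fun x hx => ?_)
      (hL.mono fun x hx => (hεW hx).1) hq.1 hq.2
    exact ((hf.contDiffOn.contDiffAt (hX.mem_nhds (hεW hx).2)).differentiableAt
      one_ne_zero).hasFDerivAt

variable {G : EuclideanSpace ℝ (Fin n) → U → EuclideanSpace ℝ (Fin n)}

theorem DiffeoHypothesisC11.generalSolution_mem (hG : DiffeoHypothesisC11 X G) (u : ℕ → U) (k : ℕ)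
    {x : EuclideanSpace ℝ (Fin n)} (hx : x ∈ X) : generalSolution G k x u ∈ X := by
  induction k with
  | zero => exact hx
  | succ k ih => exact (hG.diffeo (u k)).mapsTo ih

theorem DiffeoHypothesisC11.injOn_generalSolution (hG : DiffeoHypothesisC11 X G) (u : ℕ → U)
    (k : ℕ) : InjOn (fun x => generalSolution G k x u) X := by
  induction k with
  | zero => exact injOn_id X
  | succ k ih => exact (hG.diffeo (u k)).injOn.comp ih fun x hx => hG.generalSolution_mem u k hx

theorem DiffeoHypothesisC11.isMidpointRegularAt_generalSolution (hG : DiffeoHypothesisC11 X G)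
    (u : ℕ → U) (k : ℕ) {p : EuclideanSpace ℝ (Fin n)} (hp : p ∈ X) :
    IsMidpointRegularAt (fun x => generalSolution G k x u) p := by
  induction k with
  | zero => exact IsMidpointRegularAt.id p
  | succ k ih =>
    exact IsMidpointRegularAt.comp (f := fun x => generalSolution G k x u)
      ((hG.diffeo (u k)).isMidpointRegularAt hG.isOpen_state (hG.smooth (u k))
        (hG.generalSolution_mem u k hp)) ih

/-- There are infinitely many input sequences but only finitely many time-`k` maps, so "for small
balls" can be made uniform in `u`. -/
theorem finite_range_generalSolution [Finite U]
    (G : EuclideanSpace ℝ (Fin n) → U → EuclideanSpace ℝ (Fin n)) (k : ℕ) :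
    (range fun (u : ℕ → U) x => generalSolution G k x u).Finite := by
  induction k with
  | zero => exact (finite_singleton fun x => x).subset (by rintro _ ⟨u, rfl⟩; rfl)
  | succ k ih =>
    refine (ih.image2 (fun f w x => G (f x) w) finite_univ).subset ?_
    rintro _ ⟨u, rfl⟩
    exact ⟨_, mem_range_self u, u k, mem_univ _, rfl⟩

/-- Uniformly in the input sequence, small balls near a compact set have convex attainable sets. -/
theorem DiffeoHypothesisC11.eventually_convex_attainableSet_closedBall [Finite U]
    (hG : DiffeoHypothesisC11 X G) (N : ℕ) {p : EuclideanSpace ℝ (Fin n)} (hp : p ∈ X) :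
    ∀ᶠ q : EuclideanSpace ℝ (Fin n) × ℝ in 𝓝 p ×ˢ 𝓝[>] 0,
      ∀ k ∈ Finset.Icc 1 N, ∀ u : ℕ → U, Convex ℝ (attainableSet G k (closedBall q.1 q.2) u) := by
  rw [Filter.eventually_all_finset]
  intro k _
  have := (Filter.eventually_all_finite (finite_range_generalSolution G k)
    (l := 𝓝 p ×ˢ 𝓝[>] 0) (p := fun f (q : EuclideanSpace ℝ (Fin n) × ℝ) =>
      Convex ℝ (f '' closedBall q.1 q.2))).2 (by
    rintro _ ⟨u, rfl⟩
    exact (hG.isMidpointRegularAt_generalSolution u k hp).eventually_convex_image_closedBall)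
  filter_upwards [this] with q hq u
  exact hq _ (mem_range_self u)

/-- Small strongly convex sets have convex attainable sets. -/
theorem DiffeoHypothesisC11.convex_attainableSet_iInter (hG : DiffeoHypothesisC11 X G) {k : ℕ}
    {u : ℕ → U} {M : Set (EuclideanSpace ℝ (Fin n))} (hM : M.Nonempty) {r : ℝ}
    (hMX : ∀ c ∈ M, closedBall c r ⊆ X)
    (hconv : ∀ c ∈ M, Convex ℝ (attainableSet G k (closedBall c r) u)) :
    Convex ℝ (attainableSet G k (⋂ c ∈ M, closedBall c r) u) := by
  -- Injectivity on the union of the balls turns the image of the intersection into the intersection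
  -- of the images.
  rw [attainableSet, InjOn.image_biInter_eq hM]
  · exact convex_iInter₂ hconv
  · exact (hG.injOn_generalSolution u k).mono (iUnion₂_subset hMX)

end System

end QuantizedSystem

namespace QuantizedSystem

/-! ### Polyhedra and complements of their interiors. -/

section Polyhedra

variable {n : ℕ}

theorem IsConvexPolyhedron.of_finite {ι : Type*} [Finite ι] (a : ι → EuclideanSpace ℝ (Fin n))
    (b : ι → ℝ) : IsConvexPolyhedron {x | ∀ i, inner ℝ (a i) x ≤ b i} := by
  obtain ⟨m, ⟨e⟩⟩ := Finite.exists_equiv_fin ι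
  refine ⟨m, a ∘ e.symm, b ∘ e.symm, ?_⟩
  ext x
  exact (e.symm.surjective.forall (p := fun i => inner ℝ (a i) x ≤ b i))

theorem IsConvexPolyhedron.inter {P Q : Set (EuclideanSpace ℝ (Fin n))}
    (hP : IsConvexPolyhedron P) (hQ : IsConvexPolyhedron Q) : IsConvexPolyhedron (P ∩ Q) := by
  obtain ⟨m, a, b, rfl⟩ := hP
  obtain ⟨m', a', b', rfl⟩ := hQ
  convert IsConvexPolyhedron.of_finite (Sum.elim a a') (Sum.elim b b') using 1
  ext x
  simp [Sum.forall]

theorem isConvexPolyhedron_univ : IsConvexPolyhedron (univ : Set (EuclideanSpace ℝ (Fin n))) :=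
  ⟨0, Fin.elim0, Fin.elim0, by simp⟩

theorem isConvexPolyhedron_halfSpace (a : EuclideanSpace ℝ (Fin n)) (b : ℝ) :
    IsConvexPolyhedron {x | b ≤ inner ℝ a x} := by
  convert IsConvexPolyhedron.of_finite (fun _ : Unit => -a) (fun _ => -b) using 1
  ext x
  simp

theorem singleton_add_smul_eq_preimage {E : Type*} [AddCommGroup E] [Module ℝ E] (z : E) {t : ℝ}
    (ht : t ≠ 0) (S : Set E) : {z} + t • S = (fun x => t⁻¹ • (x - z)) ⁻¹' S := by
  ext x
  rw [singleton_add, mem_preimage, ← mem_smul_set_iff_inv_smul_mem₀ ht, image_add_left,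
    mem_preimage, neg_add_eq_sub]

theorem IsConvexPolyhedron.singleton_add_smul {P : Set (EuclideanSpace ℝ (Fin n))}
    (hP : IsConvexPolyhedron P) (z : EuclideanSpace ℝ (Fin n)) {t : ℝ} (ht : 0 < t) :
    IsConvexPolyhedron ({z} + t • P) := by
  obtain ⟨m, a, b, rfl⟩ := hP
  refine ⟨m, a, fun i => t * b i + inner ℝ (a i) z, ?_⟩
  rw [singleton_add_smul_eq_preimage z ht.ne']
  ext x
  refine forall_congr' fun i => ?_
  rw [inner_smul_right, inner_sub_right, inv_mul_le_iff₀ ht, sub_le_iff_le_add]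

/-- The complement of the interior of a nonempty convex polyhedron is a finite union of convex
polyhedra. -/
theorem IsConvexPolyhedron.exists_sUnion_eq_compl_interior {P : Set (EuclideanSpace ℝ (Fin n))}
    (hP : IsConvexPolyhedron P) (hne : P.Nonempty) :
    ∃ D : Set (Set (EuclideanSpace ℝ (Fin n))), D.Finite ∧ (∀ Δ ∈ D, IsConvexPolyhedron Δ) ∧
      ⋃₀ D = (interior P)ᶜ := by
  obtain ⟨m, a, b, rfl⟩ := hP
  obtain ⟨x₀, hx₀⟩ := hne
  -- Zero normals are dropped: as `P` is nonempty, their inequalities hold everywhere. For the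
  -- others, a step along `a i` from the reversed half-space leaves `P`.
  refine ⟨(fun i => {x | b i ≤ inner ℝ (a i) x}) '' {i | a i ≠ 0}, (toFinite _).image _, ?_, ?_⟩
  · rintro _ ⟨i, -, rfl⟩
    exact isConvexPolyhedron_halfSpace _ _
  refine Subset.antisymm ?_ ?_
  · rintro x ⟨_, ⟨i, hi, rfl⟩, hx⟩ hxint
    have hcont : Tendsto (fun t : ℝ => x + t • a i) (𝓝[>] 0) (𝓝 x) := by
      have h : Continuous fun t : ℝ => x + t • a i := by fun_prop
      have := h.tendsto 0
      rw [zero_smul, add_zero] at this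
      exact this.mono_left nhdsWithin_le_nhds
    obtain ⟨t, ht, ht0⟩ :=
      ((hcont.eventually (mem_interior_iff_mem_nhds.1 hxint)).and self_mem_nhdsWithin).exists
    have h1 : inner ℝ (a i) (x + t • a i) ≤ b i := ht i
    rw [inner_add_right, inner_smul_right, real_inner_self_eq_norm_sq] at h1
    have h2 : 0 < t * ‖a i‖ ^ 2 := mul_pos ht0 (pow_pos (norm_pos_iff.2 hi) 2)
    have h3 : b i ≤ inner ℝ (a i) x := hx
    linarith
  · intro x hx
    by_contra hc
    refine hx (mem_interior.2 ⟨⋂ i, {y | a i ≠ 0 → inner ℝ (a i) y < b i}, ?_, ?_, ?_⟩)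
    · intro y hy i
      by_cases hi : a i = 0
      · have := hx₀ i
        rwa [hi, inner_zero_left] at this ⊢
      · exact (mem_iInter.1 hy i hi).le
    · refine isOpen_iInter_of_finite fun i => ?_
      by_cases hi : a i = 0
      · simp [hi]
      · simp only [ne_eq, hi, not_false_eq_true, true_imp_iff]
        exact isOpen_lt (by fun_prop) continuous_const
    · refine mem_iInter.2 fun i hi => ?_
      by_contra h
      exact hc ⟨_, ⟨i, hi, rfl⟩, not_lt.1 h⟩

/-- Intersection distributes over finite unions, and intersections of polyhedra are polyhedra. -/
theorem exists_sUnion_eq_iInter_compl_interior {C : Set (Set (EuclideanSpace ℝ (Fin n)))}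
    (hC : C.Finite) (hpoly : ∀ P ∈ C, IsConvexPolyhedron P) (hne : ∀ P ∈ C, P.Nonempty) :
    ∃ D : Set (Set (EuclideanSpace ℝ (Fin n))), D.Finite ∧ (∀ Δ ∈ D, IsConvexPolyhedron Δ) ∧
      ⋃₀ D = ⋂ P ∈ C, (interior P)ᶜ := by
  induction C, hC using Set.Finite.induction_on with
  | empty => exact ⟨{univ}, finite_singleton _, by simp [isConvexPolyhedron_univ], by simp⟩
  | @insert P C _ _ ih =>
    obtain ⟨D, hD, hDpoly, hDU⟩ := ih (fun Q hQ => hpoly Q (mem_insert_of_mem _ hQ))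
      fun Q hQ => hne Q (mem_insert_of_mem _ hQ)
    obtain ⟨D', hD', hDpoly', hDU'⟩ :=
      (hpoly P (mem_insert _ _)).exists_sUnion_eq_compl_interior (hne P (mem_insert _ _))
    refine ⟨image2 (· ∩ ·) D' D, hD'.image2 _ hD, ?_, ?_⟩
    · rintro _ ⟨Q, hQ, R, hR, rfl⟩
      exact (hDpoly' Q hQ).inter (hDpoly R hR)
    · rw [biInter_insert, ← hDU, ← hDU', sUnion_inter_sUnion, sUnion_image2, biUnion_prod']

/-- Finitely many nonempty convex polyhedra can be completed to a finite covering of the space by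
further polyhedra that avoid the interiors of the given ones. -/
theorem exists_polyhedral_completion {C : Set (Set (EuclideanSpace ℝ (Fin n)))}
    (hC : C.Finite) (hpoly : ∀ P ∈ C, IsConvexPolyhedron P) (hne : ∀ P ∈ C, P.Nonempty) :
    ∃ D : Set (Set (EuclideanSpace ℝ (Fin n))), D.Finite ∧ (∀ Δ ∈ D, IsConvexPolyhedron Δ) ∧
      (∀ Δ ∈ D, Δ.Nonempty) ∧ ⋃₀ (C ∪ D) = univ ∧
      ∀ Δ ∈ D, ∀ P ∈ C, Δ ∩ interior P = ∅ := by
  obtain ⟨D, hD, hDpoly, hDU⟩ := exists_sUnion_eq_iInter_compl_interior hC hpoly hne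
  refine ⟨{Δ ∈ D | Δ.Nonempty}, hD.subset (sep_subset _ _), fun Δ h => hDpoly Δ h.1,
    fun Δ h => h.2, eq_univ_of_forall fun x => ?_, fun Δ h P hP => ?_⟩
  · by_cases hx : x ∈ ⋃₀ D
    · obtain ⟨Δ, hΔ, hxΔ⟩ := hx
      exact ⟨Δ, Or.inr ⟨hΔ, x, hxΔ⟩, hxΔ⟩
    · rw [hDU] at hx
      simp only [mem_iInter, not_forall, mem_compl_iff, not_not] at hx
      obtain ⟨P, hP, hxP⟩ := hx
      exact ⟨P, Or.inl hP, interior_subset hxP⟩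
  · refine eq_empty_of_forall_notMem fun x hx => ?_
    have h1 : x ∈ ⋃₀ D := ⟨Δ, h.1, hx.1⟩
    rw [hDU] at h1
    exact mem_iInter₂.1 h1 P hP hx.2

end Polyhedra

theorem singleton_add_smul_biInter_closedBall {E : Type*} [NormedAddCommGroup E] [NormedSpace ℝ E]
    (z : E) {t : ℝ} (ht : 0 < t) (M : Set E) (r : ℝ) :
    {z} + t • ⋂ x ∈ M, closedBall x r =
      ⋂ c ∈ (fun x => z + t • x) '' M, closedBall c (t * r) := by
  rw [singleton_add_smul_eq_preimage z ht.ne', preimage_iInter₂, biInter_image]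
  refine iInter₂_congr fun x _ => ?_
  ext y
  rw [mem_preimage, mem_closedBall_iff_norm, mem_closedBall_iff_norm,
    show y - (z + t • x) = t • (t⁻¹ • (y - z) - x) by
      rw [smul_sub, smul_inv_smul₀ ht.ne', sub_sub], norm_smul, Real.norm_of_nonneg ht.le,
    mul_le_mul_iff_right₀ ht]

theorem mem_interior_singleton_add_smul {E : Type*} [NormedAddCommGroup E] [NormedSpace ℝ E]
    {z x : E} {t : ℝ} (ht : t ≠ 0) {S : Set E} (hx : t⁻¹ • (x - z) ∈ interior S) :
    x ∈ interior ({z} + t • S) := by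
  rw [singleton_add_smul_eq_preimage z ht]
  exact preimage_interior_subset_interior_preimage (by fun_prop) hx

/-- Around each point `p` of a compact set, the copies of a strongly convex set that are scaled by
one sufficiently small factor and translated so as to move a given point to `p` have convex
attainable sets. -/
theorem DiffeoHypothesisC11.exists_scale {n : ℕ} {U : Type*} [Finite U]
    {X : Set (EuclideanSpace ℝ (Fin n))}
    {G : EuclideanSpace ℝ (Fin n) → U → EuclideanSpace ℝ (Fin n)}
    (hG : DiffeoHypothesisC11 X G) (N : ℕ) {K V : Set (EuclideanSpace ℝ (Fin n))}
    (hK : IsCompact K) (hV : IsOpen V) (hKV : K ⊆ V) (hVX : V ⊆ X)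
    {S : Set (EuclideanSpace ℝ (Fin n))} (hS : IsStronglyConvex S) (hS_ne : S ≠ univ)
    {y₀ : EuclideanSpace ℝ (Fin n)} (hy₀ : y₀ ∈ S) :
    ∃ lam : ℝ, 0 < lam ∧ ∀ p ∈ K, {p - lam • y₀} + lam • S ⊆ V ∧
      ∀ k ∈ Finset.Icc 1 N, ∀ u : ℕ → U,
        Convex ℝ (attainableSet G k ({p - lam • y₀} + lam • S) u) := by
  obtain ⟨r, hr, M, hM⟩ := hS
  have hMne : M.Nonempty := by
    rw [nonempty_iff_ne_empty]
    rintro rfl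
    exact hS_ne (by rw [hM, biInter_empty])
  have hy₀M : ∀ x ∈ M, ‖x - y₀‖ ≤ r := fun x hx => by
    have h : y₀ ∈ ⋂ x ∈ M, closedBall x r := hM ▸ hy₀
    rw [norm_sub_rev]
    exact mem_closedBall_iff_norm.1 (mem_iInter₂.1 h x hx)
  have hloc : ∀ p ∈ K, ∀ᶠ q : EuclideanSpace ℝ (Fin n) × ℝ in 𝓝 p ×ˢ 𝓝[>] 0,
      closedBall q.1 q.2 ⊆ V ∧ ∀ k ∈ Finset.Icc 1 N, ∀ u : ℕ → U,
        Convex ℝ (attainableSet G k (closedBall q.1 q.2) u) := by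
    intro p hp
    filter_upwards [eventually_prod_closedBall_subset (hV.mem_nhds (hKV hp)),
      hG.eventually_convex_attainableSet_closedBall N (hVX (hKV hp))] with q h1 h2
    exact ⟨h1, h2⟩
  -- Tube lemma: one neighborhood of `K` for the centers and one set of radii for all of them.
  obtain ⟨A, hA, B, hB, hAB⟩ := mem_prod_iff.1 (hK.mem_nhdsSet_prod_of_forall hloc)
  have hAB' : ∀ c ∈ A, ∀ ρ ∈ B, closedBall c ρ ⊆ V ∧ ∀ k ∈ Finset.Icc 1 N, ∀ u : ℕ → U,
      Convex ℝ (attainableSet G k (closedBall c ρ) u) := by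
    intro c hc ρ hρ
    have h : (c, ρ) ∈ A ×ˢ B := ⟨hc, hρ⟩
    have h' := hAB h
    rwa [mem_ofPred_eq] at h'
  obtain ⟨δ, hδ, hδA⟩ := (hasBasis_nhdsSet_cthickening hK).mem_iff.1 hA
  obtain ⟨ρ, hρB, hρ0, hρδ⟩ :=
    Filter.nonempty_of_mem (inter_mem hB (Ioo_mem_nhdsGT hδ))
  obtain ⟨lam, hlam, rfl⟩ : ∃ lam, 0 < lam ∧ lam * r = ρ :=
    ⟨ρ / r, div_pos hρ0 hr, div_mul_cancel₀ _ hr.ne'⟩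
  have hballs : ∀ p ∈ K, ∀ c ∈ (fun x => p - lam • y₀ + lam • x) '' M,
      closedBall c (lam * r) ⊆ V ∧ ∀ k ∈ Finset.Icc 1 N, ∀ u : ℕ → U,
        Convex ℝ (attainableSet G k (closedBall c (lam * r)) u) := by
    rintro p hp _ ⟨x, hx, rfl⟩
    -- Since `y₀` lies in every ball, centers move from `p` by at most `lam * r < δ`.
    suffices hdist : dist (p - lam • y₀ + lam • x) p ≤ δ from
      hAB' _ (hδA (mem_cthickening_of_dist_le _ p _ _ hp hdist)) _ hρB
    rw [dist_eq_norm, show p - lam • y₀ + lam • x - p = lam • (x - y₀) by module, norm_smul,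
      Real.norm_of_nonneg hlam.le]
    exact (mul_le_mul_of_nonneg_left (hy₀M x hx) hlam.le).trans hρδ.le
  refine ⟨lam, hlam, fun p hp => ?_⟩
  rw [hM, singleton_add_smul_biInter_closedBall _ hlam]
  obtain ⟨c, hc⟩ := hMne.image fun x => p - lam • y₀ + lam • x
  refine ⟨(biInter_subset_of_mem hc).trans (hballs p hp c hc).1, fun k hk u => ?_⟩
  exact hG.convex_attainableSet_iInter ⟨c, hc⟩ (fun c hc => (hballs p hp c hc).1.trans hVX)
    fun c hc => (hballs p hp c hc).2 k hk u

end QuantizedSystem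

/-! ### Assembly of the quantizer. -/

theorem mainTheorem4 {n : ℕ} {U : Type*} [Finite U]
    (X : Set (EuclideanSpace ℝ (Fin n)))
    (G : EuclideanSpace ℝ (Fin n) → U → EuclideanSpace ℝ (Fin n))
    (hG : QuantizedSystem.DiffeoHypothesisC11 X G)
    (N : ℕ)
    (K V : Set (EuclideanSpace ℝ (Fin n)))
    (hK : IsCompact K) (hV : IsOpen V) (hKV : K ⊆ V) (hVX : V ⊆ X)
    (Y Yhat : Set (EuclideanSpace ℝ (Fin n)))
    (hY : QuantizedSystem.IsConvexPolyhedron Y) (hYfull : (interior Y).Nonempty)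
    (hYhat : QuantizedSystem.IsStronglyConvex Yhat)
    (hYYhat : Y ⊆ Yhat) (hYhat_ne : Yhat ≠ Set.univ) :
    ∃ (Z : Set (EuclideanSpace ℝ (Fin n))) (lam : ℝ)
      (C : Set (Set (EuclideanSpace ℝ (Fin n)))),
      Z.Finite ∧ 0 < lam ∧
      QuantizedSystem.QuantizerHypothesis X G N C (QuantizedSystem.scaledCopies Z lam Y) ∧
      (∀ z ∈ Z, ∀ k ∈ Finset.Icc 1 N, ∀ u : ℕ → U,
        Convex ℝ (QuantizedSystem.attainableSet G k ({z} + lam • Yhat) u)) ∧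
      K ⊆ Z + lam • Y ∧ Z + lam • Y ⊆ Z + lam • Yhat ∧ Z + lam • Yhat ⊆ V ∧
      (∀ Δ ∈ C \ QuantizedSystem.scaledCopies Z lam Y,
        ∀ Δ' ∈ QuantizedSystem.scaledCopies Z lam Y, Δ ∩ interior Δ' = ∅) ∧
      (∀ Δ ∈ C \ QuantizedSystem.scaledCopies Z lam Y, Δ ∩ K = ∅) := by
  open QuantizedSystem in
  obtain ⟨y₀, hy₀⟩ := hYfull
  obtain ⟨lam, hlam, hscale⟩ :=
    hG.exists_scale N hK hV hKV hVX hYhat hYhat_ne (hYYhat (interior_subset hy₀))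
  -- Anchoring at an interior point `y₀` of `Y` puts each `p` in the interior of its own cell.
  -- Covering `K` by interiors also makes the added cells miss `K`.
  obtain ⟨T, hTK, hT, hKT⟩ := hK.elim_finite_subcover_image (b := K)
    (c := fun p => interior ({p - lam • y₀} + lam • Y)) (fun _ _ => isOpen_interior)
    fun p hp => mem_iUnion₂.2 ⟨p, hp, mem_interior_singleton_add_smul hlam.ne' (by
      rwa [sub_sub_cancel, inv_smul_smul₀ hlam.ne'])⟩
  set Z := (fun p => p - lam • y₀) '' T
  have hZ : Z.Finite := hT.image _
  have hZV : ∀ z ∈ Z, {z} + lam • Yhat ⊆ V := by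
    rintro _ ⟨p, hp, rfl⟩
    exact (hscale p (hTK hp)).1
  have hZconv : ∀ z ∈ Z, ∀ k ∈ Finset.Icc 1 N, ∀ u : ℕ → U,
      Convex ℝ (attainableSet G k ({z} + lam • Yhat) u) := by
    rintro _ ⟨p, hp, rfl⟩
    exact (hscale p (hTK hp)).2
  have hKint : ∀ x ∈ K, ∃ Δ ∈ scaledCopies Z lam Y, x ∈ interior Δ := fun x hx => by
    obtain ⟨p, hp, hxp⟩ := mem_iUnion₂.1 (hKT hx)
    exact ⟨_, mem_image_of_mem _ (mem_image_of_mem _ hp), hxp⟩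
  have hpoly : ∀ Δ ∈ scaledCopies Z lam Y, IsConvexPolyhedron Δ := by
    rintro _ ⟨z, -, rfl⟩
    exact hY.singleton_add_smul z hlam
  have hne : ∀ Δ ∈ scaledCopies Z lam Y, Δ.Nonempty := by
    rintro _ ⟨z, -, rfl⟩
    exact (singleton_nonempty z).add (Set.Nonempty.smul_set ⟨y₀, interior_subset hy₀⟩)
  obtain ⟨D, hD, hDpoly, hDne, hcov, hdisj⟩ :=
    exists_polyhedral_completion (C := scaledCopies Z lam Y) (hZ.image _) hpoly hne
  have hdisj' : ∀ Δ ∈ (scaledCopies Z lam Y ∪ D) \ scaledCopies Z lam Y,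
      ∀ Δ' ∈ scaledCopies Z lam Y, Δ ∩ interior Δ' = ∅ :=
    fun Δ hΔ => hdisj Δ (hΔ.1.resolve_left hΔ.2)
  refine ⟨Z, lam, scaledCopies Z lam Y ∪ D, hZ, hlam, ⟨‹_›, (hZ.image _).union hD, hcov, ?_, ?_,
    subset_union_left, ?_⟩, hZconv, ?_, add_subset_add_left (smul_set_mono hYYhat), ?_, hdisj', ?_⟩
  · rintro Δ (h | h)
    exacts [hne Δ h, hDne Δ h]
  · rintro Δ (h | h)
    exacts [hpoly Δ h, hDpoly Δ h]
  · rintro _ ⟨z, hz, rfl⟩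
    exact ⟨{z} + lam • Yhat, add_subset_add_left (smul_set_mono hYYhat), (hZV z hz).trans hVX, hZconv z hz⟩
  · intro x hx
    obtain ⟨_, ⟨z, hz, rfl⟩, hxΔ⟩ := hKint x hx
    exact add_subset_add_right (singleton_subset_iff.2 hz) (interior_subset hxΔ)
  · rintro _ ⟨z, hz, y, hy, rfl⟩
    exact hZV z hz (add_mem_add (mem_singleton z) hy)
  · refine fun Δ hΔ => eq_empty_of_forall_notMem fun x hx => ?_
    obtain ⟨Δ', hΔ', hxΔ'⟩ := hKint x hx.2
    exact (hdisj' Δ hΔ Δ' hΔ').subset ⟨hx.1, hxΔ'⟩
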